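/- Let $X\subset\mathbb{R}^d$ be finite, let $C\subseteq X$, and let $\gamma>0$. For a positive semidefinite matrix $W$ write $d_W(x,y)=\sqrt{(x-y)^{\top}W(x-y)}$. Suppose $C$ has margin $\gamma$ with respect to some center, i.e. there are a point $z\in\mathbb{R}^d$ and a positive semidefinite $W\in\mathbb{R}^{d\times d}$ such that $d_W(y,z)>\sqrt{1+\gamma}\;d_W(x,z)$ for all $y\in X\setminus C$ and all $x\in C$. Let $S_C\subseteq C$ be any non-empty subset. An ellipsoid is a set $\{x\in A : d_M(x,\mu)\le 1\}$, where $A\subseteq\mathbb{R}^d$ is an affine subspace, $\mu\in A$ is its center and $M$ is a positive definite matrix; so it is full-dimensional if $A=\mathbb{R}^d$ and flat otherwise. Let $E_J(S_C)$ be the minimum-volume enclosing ellipsoid (Löwner–John ellipsoid) of $S_C$, taken in the affine hull of $S_C$ (which is $\mathbb{R}^d$ when $S_C$ is not contained in a hyperplane), and for $\Phi\ge 0$ let $\Phi E_J(S_C)$ be its scaling by $\Phi$ about its own center. Then $E_J(S_C)$ exists, and there is an ellipsoid $E$ such that $$S_C\subseteq E,\qquad E\cap(X\setminus C)=\emptyset,\qquad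 E\subseteq\Phi\,E_J(S_C),\qquad\text{where } \Phi=64\sqrt2\,d^2\max\{125,1/\gamma^3\}.$$ -/

import Mathlib

open MeasureTheory

/-- The pseudo-metric `d_W(x, y) = √((x - y)ᵀ W (x - y))` on `ℝ^d` induced by a matrix `W`. -/
noncomputable def matrixDist {d : ℕ} (W : Matrix (Fin d) (Fin d) ℝ)
    (x y : EuclideanSpace ℝ (Fin d)) : ℝ :=
  Real.sqrt (dotProduct (x - y).ofLp (W.mulVec (x - y).ofLp))

/-- The cluster `C` of the point set `X` has margin `γ` with respect to the center `z`: for some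
positive semidefinite matrix `W`, every point `y` of `X` outside `C` and every point `x` of `C`
satisfy `d_W(y, z) > √(1 + γ) d_W(x, z)`. -/
def HasMarginAt {d : ℕ} (X C : Set (EuclideanSpace ℝ (Fin d))) (γ : ℝ)
    (z : EuclideanSpace ℝ (Fin d)) : Prop :=
  ∃ W : Matrix (Fin d) (Fin d) ℝ, W.PosSemidef ∧
    ∀ y ∈ X \ C, ∀ x ∈ C, matrixDist W y z > Real.sqrt (1 + γ) * matrixDist W x z

/-- An ellipsoid inside an affine subspace of `ℝ^d`, given by the subspace, a center in it and a
positive definite matrix. It is full-dimensional when `space = ⊤`, and flat otherwise. Only the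
restriction of the quadratic form to `space.direction` matters, and every positive definite form
on the direction arises in this way. -/
structure Ellipsoid (d : ℕ) where
  /-- the affine subspace that the ellipsoid spans -/
  space : AffineSubspace ℝ (EuclideanSpace ℝ (Fin d))
  /-- the center -/
  center : EuclideanSpace ℝ (Fin d)
  center_mem : center ∈ space
  /-- the matrix of the quadratic form -/
  shape : Matrix (Fin d) (Fin d) ℝ
  shape_posDef : shape.PosDef

namespace Ellipsoid

/-- The point set `{x ∈ space : d_M(x, center) ≤ 1}` of the ellipsoid. -/
def toSet {d : ℕ} (E : Ellipsoid d) : Set (EuclideanSpace ℝ (Fin d)) :=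
  {x | x ∈ E.space ∧ matrixDist E.shape x E.center ≤ 1}

/-- The ellipsoid scaled by the factor `t` about its own center, as a point set. -/
def scale {d : ℕ} (t : ℝ) (E : Ellipsoid d) : Set (EuclideanSpace ℝ (Fin d)) :=
  (fun x => E.center + t • (x - E.center)) '' E.toSet

/-- The volume of the ellipsoid, measured in the affine subspace that it spans (Lebesgue measure
of the dimension of that subspace, for the Euclidean structure inherited from `ℝ^d`). -/
noncomputable def vol {d : ℕ} (E : Ellipsoid d) : ENNReal :=
  volume {v : E.space.direction | E.center + (v : EuclideanSpace ℝ (Fin d)) ∈ E.toSet}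

end Ellipsoid

/-- `J` is the minimum-volume enclosing ellipsoid (Löwner-John ellipsoid) of the set `S`, taken in
the affine hull of `S`. -/
def IsMVEE {d : ℕ} (S : Set (EuclideanSpace ℝ (Fin d))) (J : Ellipsoid d) : Prop :=
  J.space = affineSpan ℝ S ∧ S ⊆ J.toSet ∧
    ∀ F : Ellipsoid d, F.space = affineSpan ℝ S → S ⊆ F.toSet → J.vol ≤ F.vol

/-- The ellipsoid `E` separates the set `S` from the set `T`. -/
def Ellipsoid.Separates {d : ℕ} (E : Ellipsoid d) (S T : Set (EuclideanSpace ℝ (Fin d))) : Prop :=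
  S ⊆ E.toSet ∧ Disjoint E.toSet T

/-!
Existence of the minimum-volume ellipsoid. In the direction space `V` of the affine hull of `S`,
the enclosing ellipsoids are exactly the sets `{v | ‖B v - b‖ ≤ 1}` with `B` an invertible
endomorphism of `V`, and such a set has volume `|det B|⁻¹` times that of the unit ball. The pairs
`(B, b)` for which this set contains `S` form a compact set, because `S` spans `V`, so `|det B|`
attains a maximum there, which is positive (`exists_linearMap_maximal_det`, `exists_isMVEE`).

Separation. The sublevel sets of `d_W(·, z)` separate `S` from `X \ C` but may be unbounded, since
`W` is only semidefinite. Let `r` be the largest value of `d_W(·, z)` on `C` and let `J` be any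
enclosing ellipsoid of `S` in its affine hull, with form `M` and center `c`. For `r > 0`, put
`q(x) = d_W(x, z)² + (r² γ / 2) d_M(x, c)²` and `E = {q ≤ (1 + γ) r²}` within the affine hull. On
`S`, `q ≤ r² + r² γ / 2 < (1 + γ) r²`. On `X \ C`, the margin alone gives
`q ≥ d_W(·, z)² > (1 + γ) r²`. And `q ≤ (1 + γ) r²` forces `d_M(x, c)² ≤ 2 (1 + γ) / γ`, which for
`d ≥ 1` is less than the square of the required factor. For `r = 0`, `d_W(·, z)`
vanishes on the affine hull of `S`, and `E = J` serves
(`Ellipsoid.exists_separates`). Minimality of `J` plays no role here.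

Quadratic forms are written as `x ↦ ‖φ x‖²` with `φ` linear. Completing the square for `q` then
becomes an orthogonal projection (`exists_ellipsoid_mem_toSet_iff`), which also turns the maximal
pair `(B, b)` into an ellipsoid.
-/

/-! ### Quadratic forms as norms of linear images -/

section

open scoped InnerProductSpace ComplexOrder MatrixOrder

lemma Matrix.PosSemidef.exists_linearMap_matrixDist_eq_norm {d : ℕ}
    {M : Matrix (Fin d) (Fin d) ℝ} (hM : M.PosSemidef) :
    ∃ T : EuclideanSpace ℝ (Fin d) →ₗ[ℝ] EuclideanSpace ℝ (Fin d),
      ∀ x y, matrixDist M x y = ‖T (x - y)‖ := by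
  obtain ⟨B, rfl⟩ := CStarAlgebra.nonneg_iff_eq_star_mul_self.mp hM.nonneg
  refine ⟨Matrix.toEuclideanLin B, fun x y => ?_⟩
  rw [matrixDist, ← Matrix.mulVec_mulVec, Matrix.dotProduct_mulVec, EuclideanSpace.norm_eq]
  congr 1
  rw [Matrix.star_eq_conjTranspose, Matrix.conjTranspose_eq_transpose_of_trivial,
    Matrix.vecMul_transpose, dotProduct]
  exact Finset.sum_congr rfl fun i _ => by simp [sq, Matrix.mulVec_sub]

lemma Matrix.PosDef.exists_injective_matrixDist_eq_norm {d : ℕ}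
    {M : Matrix (Fin d) (Fin d) ℝ} (hM : M.PosDef) :
    ∃ T : EuclideanSpace ℝ (Fin d) →ₗ[ℝ] EuclideanSpace ℝ (Fin d), Function.Injective T ∧
      ∀ x y, matrixDist M x y = ‖T (x - y)‖ := by
  obtain ⟨T, hT⟩ := hM.posSemidef.exists_linearMap_matrixDist_eq_norm
  refine ⟨T, (injective_iff_map_eq_zero T).2 fun v hv => ?_, hT⟩
  by_contra hne
  have hpos := hM.dotProduct_mulVec_pos (x := v.ofLp) (by simpa using hne)
  have h0 : matrixDist M v 0 = 0 := by rw [hT, sub_zero, hv, norm_zero]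
  rw [matrixDist, sub_zero] at h0
  exact (Real.sqrt_pos.2 (by simpa using hpos)).ne' h0

/-- Every injective linear map induces a positive definite quadratic form: its matrix is the Gram
matrix of the images of the standard basis. -/
lemma exists_posDef_matrixDist_eq_norm {d : ℕ} {F : Type*} [NormedAddCommGroup F]
    [InnerProductSpace ℝ F] (φ : EuclideanSpace ℝ (Fin d) →ₗ[ℝ] F) (hφ : Function.Injective φ) :
    ∃ M : Matrix (Fin d) (Fin d) ℝ, M.PosDef ∧ ∀ x y, matrixDist M x y = ‖φ (x - y)‖ := by
  set e := (EuclideanSpace.basisFun (Fin d) ℝ).toBasis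
  refine ⟨Matrix.gram ℝ (φ ∘ e), Matrix.posDef_gram_of_linearIndependent
    (e.linearIndependent.map' φ (LinearMap.ker_eq_bot.2 hφ)), fun x y => ?_⟩
  have h := Matrix.star_dotProduct_gram_mulVec (𝕜 := ℝ) (φ ∘ e) (x - y).ofLp (x - y).ofLp
  have hsum : ∑ i, (x - y).ofLp i • (φ ∘ e) i = φ (x - y) := by
    conv_rhs => rw [← e.sum_repr (x - y)]
    simp [e, map_sum]
  rw [star_trivial, hsum, real_inner_self_eq_norm_sq] at h
  rw [matrixDist, h, Real.sqrt_sq (norm_nonneg _)]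

/-- A sublevel set of `x ↦ ‖φ (x - c) + a‖` on an affine subspace, with `φ` linear and injective,
is an ellipsoid. Its center is the point whose image is nearest to `-a`; the strict inequality at
some point ensures that the ellipsoid has positive radius. -/
lemma exists_ellipsoid_mem_toSet_iff {d : ℕ} {F : Type*} [NormedAddCommGroup F]
    [InnerProductSpace ℝ F] (A : AffineSubspace ℝ (EuclideanSpace ℝ (Fin d)))
    (φ : EuclideanSpace ℝ (Fin d) →ₗ[ℝ] F) (hφ : Function.Injective φ) (a : F) {ρ : ℝ}
    {c p : EuclideanSpace ℝ (Fin d)} (hc : c ∈ A) (hp : p ∈ A) (hlt : ‖φ (p - c) + a‖ < ρ) :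
    ∃ E : Ellipsoid d, E.space = A ∧ ∀ x, x ∈ E.toSet ↔ x ∈ A ∧ ‖φ (x - c) + a‖ ≤ ρ := by
  set U : Submodule ℝ F := A.direction.map φ
  obtain ⟨w, hw, hwa⟩ := Submodule.mem_map.1 (U.starProjection_apply_mem (-a))
  have hcw : w + c ∈ A := AffineSubspace.vadd_mem_of_mem_direction hw hc
  have hpyth : ∀ x ∈ A, ‖φ (x - c) + a‖ ^ 2 = ‖φ (x - (w + c))‖ ^ 2 + ‖φ w + a‖ ^ 2 := by
    intro x hx
    have hU : φ (x - (w + c)) ∈ U :=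
      Submodule.mem_map_of_mem (AffineSubspace.vsub_mem_direction hx hcw)
    have horth : ⟪φ (x - (w + c)), φ w + a⟫_ℝ = 0 := by
      have := U.starProjection_inner_eq_zero (-a) _ hU
      rw [← hwa, real_inner_comm] at this
      rw [← neg_eq_zero, ← inner_neg_right, ← this]
      congr 1
      abel
    have hsplit : φ (x - c) + a = φ (x - (w + c)) + (φ w + a) := by
      simp only [map_sub, map_add]
      abel
    rw [hsplit, sq, norm_add_sq_eq_norm_sq_add_norm_sq_of_inner_eq_zero _ _ horth, sq, sq]
  have hρ : 0 < ρ := (norm_nonneg _).trans_lt hlt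
  have hτ : 0 < ρ ^ 2 - ‖φ w + a‖ ^ 2 := by
    have h1 := hpyth p hp
    have h2 : ‖φ (p - c) + a‖ ^ 2 < ρ ^ 2 := by gcongr
    nlinarith [sq_nonneg ‖φ (p - (w + c))‖]
  set τ := Real.sqrt (ρ ^ 2 - ‖φ w + a‖ ^ 2)
  have hτ0 : 0 < τ := Real.sqrt_pos.2 hτ
  have hτ2 : τ ^ 2 = ρ ^ 2 - ‖φ w + a‖ ^ 2 := Real.sq_sqrt hτ.le
  obtain ⟨M, hM, hMd⟩ := exists_posDef_matrixDist_eq_norm (τ⁻¹ • φ) fun u v h =>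
    hφ (smul_right_injective F (inv_pos.2 hτ0).ne' h)
  refine ⟨⟨A, w + c, hcw, M, hM⟩, rfl, fun x => and_congr_right fun hx => ?_⟩
  rw [hMd, LinearMap.smul_apply, norm_smul, Real.norm_of_nonneg (inv_pos.2 hτ0).le,
    inv_mul_le_iff₀ hτ0, mul_one, ← sq_le_sq₀ (norm_nonneg _) hτ0.le,
    ← sq_le_sq₀ (norm_nonneg _) hρ.le, hpyth x hx, hτ2]
  constructor <;> intro h <;> linarith

end

/-! ### Existence of the minimum-volume enclosing ellipsoid -/

/-- Among the affine maps `v ↦ B v - b` that send a bounded spanning set containing `0` into the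
unit ball, one has a determinant of largest absolute value, and that determinant does not vanish. -/
lemma exists_linearMap_maximal_det {V : Type*} [NormedAddCommGroup V] [InnerProductSpace ℝ V]
    [FiniteDimensional ℝ V] {T : Set V} (h0 : (0 : V) ∈ T) (hT : Bornology.IsBounded T)
    (hspan : Submodule.span ℝ T = ⊤) :
    ∃ (B : V →ₗ[ℝ] V) (b : V), LinearMap.det B ≠ 0 ∧ (∀ v ∈ T, ‖B v - b‖ ≤ 1) ∧
      ∀ (B' : V →ₗ[ℝ] V) (b' : V), (∀ v ∈ T, ‖B' v - b'‖ ≤ 1) →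
        |LinearMap.det B'| ≤ |LinearMap.det B| := by
  let K : Set ((V →L[ℝ] V) × V) := {p | ∀ v ∈ T, ‖p.1 v - p.2‖ ≤ 1}
  have hclosed : IsClosed K := by
    simp only [K, Set.ofPred_forall]
    refine isClosed_biInter fun v _ => isClosed_le ?_ continuous_const
    fun_prop
  have hbdd : Bornology.IsBounded K := by
    let β := Module.Basis.ofSpan hspan.ge
    have hβ : ∀ i, β i ∈ T := fun i =>
      Module.Basis.ofSpan_subset hspan.ge (Set.mem_range_self i)
    have : Finite ((linearIndepOn_empty ℝ (id : V → V)).extend (Set.empty_subset T)) :=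
      Module.Finite.finite_basis β
    obtain ⟨c, hc, hop⟩ := β.exists_opNorm_le (F := V)
    refine isBounded_iff_forall_norm_le.2 ⟨max (c * 2) 1, fun p hp => ?_⟩
    have hb : ‖p.2‖ ≤ 1 := by simpa using hp 0 h0
    refine max_le_max (hop zero_le_two fun i => ?_) hb
    calc ‖p.1 (β i)‖ = ‖(p.1 (β i) - p.2) + p.2‖ := by rw [sub_add_cancel]
      _ ≤ 1 + 1 := (norm_add_le _ _).trans (add_le_add (hp _ (hβ i)) hb)
      _ = 2 := one_add_one_eq_two
  have : ProperSpace ((V →L[ℝ] V) × V) := FiniteDimensional.proper ℝ _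
  have hK : IsCompact K := Metric.isCompact_of_isClosed_isBounded hclosed hbdd
  obtain ⟨R, hR⟩ := isBounded_iff_forall_norm_le.1 hT
  have hR0 : 0 ≤ R := (norm_nonneg _).trans (hR 0 h0)
  -- A small multiple of the identity is admissible, so the maximum is positive.
  let P : V →L[ℝ] V := (R + 1)⁻¹ • ContinuousLinearMap.id ℝ V
  have hP : (P, (0 : V)) ∈ K := by
    intro v hv
    have : ‖(R + 1)⁻¹ • v‖ ≤ 1 := by
      rw [norm_smul, Real.norm_of_nonneg (by positivity), inv_mul_le_iff₀ (by positivity)]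
      linarith [hR v hv]
    simpa [P] using this
  have hPdet : P.det ≠ 0 := by
    have : P.det = (R + 1)⁻¹ ^ Module.finrank ℝ V := by
      rw [ContinuousLinearMap.det]
      simp [P]
    rw [this]
    positivity
  obtain ⟨p, hp, hmax⟩ := hK.exists_isMaxOn ⟨_, hP⟩ (f := fun p => |p.1.det|)
    (ContinuousLinearMap.continuous_det.comp continuous_fst).abs.continuousOn
  refine ⟨p.1, p.2, fun h => ?_, hp, fun B' b' hB' => ?_⟩
  · have := hmax hP
    have h' : p.1.det = 0 := h
    simp only [Set.mem_ofPred_eq, h', abs_zero] at this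
    exact hPdet (abs_nonpos_iff.1 this)
  · exact hmax (show (LinearMap.toContinuousLinearMap B', b') ∈ K from hB')

/-- An ellipsoid whose preimage in the direction space is `{v | ‖B v - b‖ ≤ 1}` has volume
`|det B|⁻¹` times that of the unit ball. -/
lemma Ellipsoid.vol_eq_of_forall_mem_iff {d : ℕ} {E : Ellipsoid d}
    {A : AffineSubspace ℝ (EuclideanSpace ℝ (Fin d))} (hE : E.space = A)
    {p : EuclideanSpace ℝ (Fin d)} (hp : p ∈ A)
    {B : A.direction →ₗ[ℝ] A.direction} (hB : LinearMap.det B ≠ 0)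
    {b : A.direction}
    (h : ∀ v : A.direction,
      p + (v : EuclideanSpace ℝ (Fin d)) ∈ E.toSet ↔ ‖B v - b‖ ≤ 1) :
    E.vol = ENNReal.ofReal |(LinearMap.det B)⁻¹| *
      volume (Metric.closedBall (0 : A.direction) 1) := by
  subst hE
  let u : E.space.direction :=
    ⟨E.center - p, AffineSubspace.vsub_mem_direction E.center_mem hp⟩
  have hset : {v : E.space.direction |
      E.center + (v : EuclideanSpace ℝ (Fin d)) ∈ E.toSet} =
      (fun v => v + u) ⁻¹' (B ⁻¹' ((fun v => v + -b) ⁻¹' Metric.closedBall 0 1)) := by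
    ext v
    have hv : E.center + (v : EuclideanSpace ℝ (Fin d)) =
        p + ((v + u : E.space.direction) : EuclideanSpace ℝ (Fin d)) := by
      simp only [u, Submodule.coe_add]
      abel
    simp only [Set.mem_ofPred_eq, hv, h, Set.mem_preimage, mem_closedBall_zero_iff,
      sub_eq_add_neg]
  rw [Ellipsoid.vol, hset, measure_preimage_add_right, Measure.addHaar_preimage_linearMap _ hB,
    measure_preimage_add_right]

/-- In the direction space, seen from any base point `p`, an ellipsoid has the form
`{v | ‖B v - b‖ ≤ 1}` with `B` invertible. -/
lemma Ellipsoid.exists_linearMap_mem_toSet_iff {d : ℕ} {E : Ellipsoid d}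
    {A : AffineSubspace ℝ (EuclideanSpace ℝ (Fin d))} (hE : E.space = A)
    {p : EuclideanSpace ℝ (Fin d)} (hp : p ∈ A) :
    ∃ (B : A.direction →ₗ[ℝ] A.direction) (b : A.direction),
      LinearMap.det B ≠ 0 ∧ ∀ v : A.direction,
        p + (v : EuclideanSpace ℝ (Fin d)) ∈ E.toSet ↔ ‖B v - b‖ ≤ 1 := by
  subst hE
  obtain ⟨T, hT, hTd⟩ := E.shape_posDef.exists_injective_matrixDist_eq_norm
  let f := Submodule.equivMapOfInjective T hT E.space.direction
  -- The image under `T` is identified isometrically with the direction space, so that `T` becomes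
  -- an endomorphism and has a determinant.
  let g : (E.space.direction.map T) ≃ₗᵢ[ℝ] E.space.direction :=
    (stdOrthonormalBasis ℝ _).equiv (stdOrthonormalBasis ℝ _) (finCongr f.finrank_eq.symm)
  let B := f.trans g.toLinearEquiv
  let u : E.space.direction :=
    ⟨E.center - p, AffineSubspace.vsub_mem_direction E.center_mem hp⟩
  refine ⟨B, B u, (LinearEquiv.isUnit_det' B).ne_zero, fun v => ?_⟩
  have hmem : p + (v : EuclideanSpace ℝ (Fin d)) ∈ E.space := by
    rw [add_comm]
    exact AffineSubspace.vadd_mem_of_mem_direction v.2 hp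
  have hnorm : ‖B v - B u‖ = ‖T (p + v - E.center)‖ := by
    rw [← map_sub]
    change ‖g (f (v - u))‖ = _
    rw [g.norm_map]
    change ‖T ((v - u : E.space.direction) : EuclideanSpace ℝ (Fin d))‖ = _
    congr 2
    simp only [u, Submodule.coe_sub]
    abel
  change _ ∧ _ ↔ ‖B v - B u‖ ≤ 1
  rw [hTd, hnorm, and_iff_right hmem]

/-- A nonempty bounded set has a minimum-volume enclosing ellipsoid in its affine hull. -/
theorem exists_isMVEE {d : ℕ} {S : Set (EuclideanSpace ℝ (Fin d))} (hS : S.Nonempty)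
    (hbdd : Bornology.IsBounded S) : ∃ J : Ellipsoid d, IsMVEE S J := by
  obtain ⟨p, hp⟩ := hS
  set A := affineSpan ℝ S with hA
  have hpA : p ∈ A := mem_affineSpan ℝ hp
  let T : Set A.direction := {v | p + (v : EuclideanSpace ℝ (Fin d)) ∈ S}
  have hT0 : (0 : A.direction) ∈ T := by simpa [T] using hp
  have hTbdd : Bornology.IsBounded T := by
    obtain ⟨R, hR⟩ := isBounded_iff_forall_norm_le.1 hbdd
    refine isBounded_iff_forall_norm_le.2 ⟨R + ‖p‖, fun v hv => ?_⟩
    calc ‖v‖ = ‖(p + (v : EuclideanSpace ℝ (Fin d))) - p‖ := by rw [add_sub_cancel_left]; rfl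
      _ ≤ R + ‖p‖ := (norm_sub_le _ _).trans (by gcongr; exact hR _ hv)
  have hTspan : Submodule.span ℝ T = ⊤ := by
    have hinj : Function.Injective A.direction.subtype := Subtype.val_injective
    apply Submodule.map_injective_of_injective hinj
    have hdir : A.direction = Submodule.span ℝ ((· -ᵥ p) '' S) := by
      rw [hA, direction_affineSpan, vectorSpan_eq_span_vsub_set_right ℝ hp]
    rw [Submodule.map_span, Submodule.map_subtype_top]
    refine Eq.trans ?_ hdir.symm
    congr 1
    ext x
    simp only [Set.mem_image, vsub_eq_sub]
    constructor
    · rintro ⟨v, hv, rfl⟩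
      exact ⟨_, hv, by simp⟩
    · rintro ⟨s, hs, rfl⟩
      exact ⟨⟨s - p, AffineSubspace.vsub_mem_direction (mem_affineSpan ℝ hs) hpA⟩,
        by simpa [T] using hs, rfl⟩
  obtain ⟨B, b, hB, hBT, hmax⟩ := exists_linearMap_maximal_det hT0 hTbdd hTspan
  -- `B` acts on the direction of `A` only; the identity on the orthogonal complement extends it to
  -- an injective map, as the matrix of an ellipsoid has to be positive definite on all of `ℝ^d`.
  let φ : EuclideanSpace ℝ (Fin d) →ₗ[ℝ] WithLp 2 (A.direction × A.directionᗮ) :=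
    (WithLp.linearEquiv 2 ℝ (A.direction × A.directionᗮ)).symm.toLinearMap ∘ₗ
      LinearMap.prod (B ∘ₗ A.direction.orthogonalProjectionOnto.toLinearMap)
        A.directionᗮ.orthogonalProjectionOnto.toLinearMap
  have hφ : Function.Injective φ := by
    refine (injective_iff_map_eq_zero φ).2 fun x hx => ?_
    have h1 : B (A.direction.orthogonalProjectionOnto x) = 0 := congrArg WithLp.fst hx
    have h2 : A.directionᗮ.orthogonalProjectionOnto x = 0 := congrArg WithLp.snd hx
    have h3 : A.direction.orthogonalProjectionOnto x = 0 :=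
      (LinearMap.equivOfDetNeZero B hB).injective (h1.trans (map_zero B).symm)
    have h4 := Submodule.orthogonalProjectionOnto_eq_zero_iff.1 h3
    have h5 := Submodule.orthogonalProjectionOnto_eq_zero_iff.1 h2
    exact inner_self_eq_zero.1 (h5 x h4)
  let a : WithLp 2 (A.direction × A.directionᗮ) := WithLp.toLp 2 (-b, 0)
  have hnorm : ∀ v : A.direction, ‖φ v + a‖ = ‖B v - b‖ := by
    intro v
    have h1 : (φ v + a).fst = B v - b := by
      simp [φ, a, sub_eq_add_neg]
    have h2 : (φ v + a).snd = 0 := by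
      simp [φ, a]
    rw [← sq_eq_sq₀ (norm_nonneg _) (norm_nonneg _), WithLp.prod_norm_sq_eq_of_L2, h1, h2]
    simp
  obtain ⟨v₀, hv₀⟩ : ∃ v, B v = b := (LinearMap.equivOfDetNeZero B hB).surjective b
  have hmemA : ∀ v : A.direction, p + (v : EuclideanSpace ℝ (Fin d)) ∈ A := fun v => by
    rw [add_comm]
    exact AffineSubspace.vadd_mem_of_mem_direction v.2 hpA
  obtain ⟨J, hJA, hJ⟩ := exists_ellipsoid_mem_toSet_iff A φ hφ a (ρ := 1) hpA (hmemA v₀)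
    (by rw [add_sub_cancel_left, hnorm, hv₀, sub_self, norm_zero]; exact one_pos)
  have hJv : ∀ v : A.direction,
      p + (v : EuclideanSpace ℝ (Fin d)) ∈ J.toSet ↔ ‖B v - b‖ ≤ 1 := fun v => by
    rw [hJ, and_iff_right (hmemA v), add_sub_cancel_left, hnorm]
  have hsub : ∀ s ∈ S, ∃ v : A.direction, p + (v : EuclideanSpace ℝ (Fin d)) = s := fun s hs =>
    ⟨⟨s - p, AffineSubspace.vsub_mem_direction (mem_affineSpan ℝ hs) hpA⟩, add_sub_cancel _ _⟩
  refine ⟨J, hJA, fun s hs => ?_, fun F hFA hSF => ?_⟩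
  · obtain ⟨v, rfl⟩ := hsub s hs
    exact (hJv v).2 (hBT v hs)
  · obtain ⟨B', b', hB', hF⟩ := Ellipsoid.exists_linearMap_mem_toSet_iff hFA hpA
    rw [Ellipsoid.vol_eq_of_forall_mem_iff hJA hpA hB hJv,
      Ellipsoid.vol_eq_of_forall_mem_iff hFA hpA hB' hF, abs_inv, abs_inv]
    have := hmax B' b' fun v hv => (hF v).1 (hSF hv)
    have hpos := abs_pos.2 hB'
    gcongr

/-! ### Separation -/

lemma Ellipsoid.mem_scale_of_matrixDist_le {d : ℕ} (E : Ellipsoid d) {t : ℝ} (ht : 0 < t)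
    {x : EuclideanSpace ℝ (Fin d)} (hx : x ∈ E.space)
    (hle : matrixDist E.shape x E.center ≤ t) : x ∈ E.scale t := by
  obtain ⟨T, hT⟩ := E.shape_posDef.posSemidef.exists_linearMap_matrixDist_eq_norm
  refine ⟨t⁻¹ • (x - E.center) + E.center, ⟨?_, ?_⟩, ?_⟩
  · exact AffineSubspace.vadd_mem_of_mem_direction
      (Submodule.smul_mem _ _ (AffineSubspace.vsub_mem_direction hx E.center_mem)) E.center_mem
  · rw [hT] at hle ⊢
    rw [add_sub_cancel_right, map_smul, norm_smul, Real.norm_of_nonneg (inv_pos.2 ht).le,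
      inv_mul_le_iff₀ ht, mul_one]
    exact hle
  · simp only [add_sub_cancel_right, smul_smul, mul_inv_cancel₀ ht.ne', one_smul,
      add_sub_cancel]

/-- If `S` and `Y` are separated with margin `γ` by the `d_W`-balls of radius `r` and
`√(1 + γ) r` about `z`, and `J` is any enclosing ellipsoid of `S` in its affine hull, then adding
`r² γ / 2` times the form of `J` to `W` gives a separating ellipsoid inside
`√(2 (1 + γ) / γ) J`. -/
lemma Ellipsoid.exists_separates {d : ℕ} {S Y : Set (EuclideanSpace ℝ (Fin d))}
    {W : Matrix (Fin d) (Fin d) ℝ} (hW : W.PosSemidef) {z : EuclideanSpace ℝ (Fin d)}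
    {γ r t : ℝ} (hγ : 0 < γ) (hr : 0 ≤ r) (hSr : ∀ x ∈ S, matrixDist W x z ≤ r)
    (hYr : ∀ y ∈ Y, Real.sqrt (1 + γ) * r < matrixDist W y z) (hS : S.Nonempty)
    {J : Ellipsoid d} (hJ : J.space = affineSpan ℝ S) (hSJ : S ⊆ J.toSet)
    (ht : 1 ≤ t) (htγ : 2 * (1 + γ) / γ ≤ t ^ 2) :
    ∃ E : Ellipsoid d, E.Separates S Y ∧ E.toSet ⊆ J.scale t := by
  have ht0 : 0 < t := one_pos.trans_le ht
  obtain ⟨T, hT⟩ := hW.exists_linearMap_matrixDist_eq_norm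
  obtain ⟨U, hU, hUd⟩ := J.shape_posDef.exists_injective_matrixDist_eq_norm
  rcases hr.eq_or_lt with rfl | hr0
  · -- If `r = 0`, then `d_W(·, z)` vanishes on the whole affine hull of `S`, which therefore does not
    -- meet `Y`.
    refine ⟨J, ⟨hSJ, Set.disjoint_left.2 fun y hyJ hyY => ?_⟩, fun x hx =>
      J.mem_scale_of_matrixDist_le ht0 hx.1 (hx.2.trans ht)⟩
    have hle : affineSpan ℝ S ≤ AffineSubspace.mk' z (LinearMap.ker T) := by
      refine affineSpan_le.2 fun x hx => ?_
      have := hSr x hx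
      rw [hT, norm_le_zero_iff] at this
      exact AffineSubspace.mem_mk'.2 this
    have hy : T (y - z) = 0 := AffineSubspace.mem_mk'.1 (hle (hJ ▸ hyJ.1))
    have := hYr y hyY
    rw [hT, hy, norm_zero, mul_zero] at this
    exact this.false
  · set σ := r * Real.sqrt (γ / 2)
    have hσ : 0 < σ := by positivity
    have hσ2 : σ ^ 2 = r ^ 2 * (γ / 2) := by
      rw [mul_pow, Real.sq_sqrt (by positivity)]
    set ρ := Real.sqrt (1 + γ) * r
    have hρ : 0 < ρ := by positivity
    have hρ2 : ρ ^ 2 = (1 + γ) * r ^ 2 := by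
      rw [mul_pow, Real.sq_sqrt (by positivity)]
    let φ : EuclideanSpace ℝ (Fin d) →ₗ[ℝ]
        WithLp 2 (EuclideanSpace ℝ (Fin d) × EuclideanSpace ℝ (Fin d)) :=
      (WithLp.linearEquiv 2 ℝ _).symm.toLinearMap ∘ₗ LinearMap.prod T (σ • U)
    have hφ : Function.Injective φ := fun x y hxy =>
      hU (smul_right_injective _ hσ.ne' (congrArg WithLp.snd hxy))
    let a : WithLp 2 (EuclideanSpace ℝ (Fin d) × EuclideanSpace ℝ (Fin d)) :=
      WithLp.toLp 2 (T (J.center - z), 0)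
    have hnorm : ∀ x, ‖φ (x - J.center) + a‖ ^ 2 =
        matrixDist W x z ^ 2 + σ ^ 2 * matrixDist J.shape x J.center ^ 2 := by
      intro x
      have h1 : (φ (x - J.center) + a).fst = T (x - z) := by
        simp [φ, a]
      have h2 : (φ (x - J.center) + a).snd = σ • U (x - J.center) := by
        simp [φ, a]
      rw [WithLp.prod_norm_sq_eq_of_L2, h1, h2, norm_smul, mul_pow, hT, hUd,
        Real.norm_of_nonneg hσ.le]
    have hSlt : ∀ x ∈ S, ‖φ (x - J.center) + a‖ < ρ := by
      intro x hx
      have h1 : matrixDist W x z ^ 2 ≤ r ^ 2 :=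
        pow_le_pow_left₀ (Real.sqrt_nonneg _) (hSr x hx) 2
      have h2 : matrixDist J.shape x J.center ^ 2 ≤ 1 :=
        pow_le_one₀ (Real.sqrt_nonneg _) (hSJ hx).2
      have h3 := mul_le_of_le_one_right (sq_nonneg σ) h2
      have h4 : 0 < r ^ 2 * (γ / 2) := by positivity
      rw [← sq_lt_sq₀ (norm_nonneg _) hρ.le, hnorm, hρ2]
      linarith
    obtain ⟨p, hp⟩ := hS
    have hSJ' : ∀ x ∈ S, x ∈ J.space := fun x hx => (hSJ hx).1
    obtain ⟨E, -, hE⟩ := exists_ellipsoid_mem_toSet_iff J.space φ hφ a J.center_mem (hSJ' p hp)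
      (hSlt p hp)
    refine ⟨E, ⟨fun x hx => (hE x).2 ⟨hSJ' x hx, (hSlt x hx).le⟩,
      Set.disjoint_left.2 fun y hyE hyY => ?_⟩, fun x hx => ?_⟩
    · have h1 := ((hE y).1 hyE).2
      have h2 := hYr y hyY
      rw [← sq_le_sq₀ (norm_nonneg _) hρ.le, hnorm] at h1
      have h3 : ρ ^ 2 < matrixDist W y z ^ 2 := by gcongr
      nlinarith [sq_nonneg (σ * matrixDist J.shape y J.center)]
    · obtain ⟨hxJ, h1⟩ := (hE x).1 hx
      have hJ0 : 0 ≤ matrixDist J.shape x J.center := Real.sqrt_nonneg _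
      refine J.mem_scale_of_matrixDist_le ht0 hxJ ?_
      rw [← sq_le_sq₀ (norm_nonneg _) hρ.le, hnorm, hρ2, hσ2] at h1
      rw [← sq_le_sq₀ hJ0 ht0.le]
      refine le_trans ?_ htγ
      rw [le_div_iff₀ hγ]
      have hr2 : 0 < r ^ 2 := by positivity
      refine le_of_mul_le_mul_left ?_ hr2
      linarith [sq_nonneg (matrixDist W x z)]

theorem theorem3 {d : ℕ} (X C S : Set (EuclideanSpace ℝ (Fin d))) (hX : X.Finite) (hCX : C ⊆ X)
    (γ : ℝ) (hγ : 0 < γ) (hC : ∃ z : EuclideanSpace ℝ (Fin d), HasMarginAt X C γ z)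
    (hSC : S ⊆ C) (hS : S.Nonempty) :
    (∃ J : Ellipsoid d, IsMVEE S J) ∧
      ∀ J : Ellipsoid d, IsMVEE S J →
        ∃ E : Ellipsoid d, E.Separates S (X \ C) ∧
          E.toSet ⊆ J.scale (64 * Real.sqrt 2 * (d : ℝ) ^ 2 * max 125 (1 / γ ^ 3)) := by
  refine ⟨exists_isMVEE hS (hX.subset (hSC.trans hCX)).isBounded, fun J ⟨hJ, hSJ, _⟩ => ?_⟩
  obtain ⟨z, W, hW, hmargin⟩ := hC
  obtain ⟨x₀, hx₀, hmax⟩ :=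
    (hX.subset hCX).exists_maximalFor (fun x => matrixDist W x z) C (hS.mono hSC)
  have hmax' : ∀ x ∈ C, matrixDist W x z ≤ matrixDist W x₀ z := fun x hx =>
    (le_total _ _).elim id fun h => hmax hx h
  rcases Nat.eq_zero_or_pos d with rfl | hd
  · -- In dimension `0` the factor vanishes, but all points coincide.
    obtain ⟨s, hs⟩ := hS
    exact ⟨J, ⟨hSJ, Set.disjoint_left.2 fun y _ hy =>
      hy.2 (Subsingleton.elim s y ▸ hSC hs)⟩,
      fun x hx => ⟨x, hx, Subsingleton.elim _ _⟩⟩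
  set m := max 125 (1 / γ ^ 3)
  have hm : 125 ≤ m := le_max_left _ _
  have hγm : γ⁻¹ ≤ m := by
    rcases le_total γ⁻¹ 1 with h | h
    · linarith
    · refine (le_self_pow₀ h three_ne_zero).trans ?_
      rw [inv_pow, ← one_div]
      exact le_max_right _ _
  have hd1 : (1 : ℝ) ≤ (d : ℝ) ^ 2 := one_le_pow₀ (by exact_mod_cast hd)
  have h2 : (1 : ℝ) ≤ Real.sqrt 2 := Real.one_le_sqrt.2 one_le_two
  have hmt : m ≤ 64 * Real.sqrt 2 * (d : ℝ) ^ 2 * m := by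
    refine le_mul_of_one_le_left (by linarith) ?_
    exact one_le_mul_of_one_le_of_one_le (by linarith) hd1
  refine Ellipsoid.exists_separates hW hγ (Real.sqrt_nonneg _) (fun x hx => hmax' x (hSC hx))
    (fun y hy => hmargin y hy x₀ hx₀) hS hJ hSJ (by linarith) ?_
  calc 2 * (1 + γ) / γ = 2 * γ⁻¹ + 2 := by field_simp
    _ ≤ m ^ 2 := by nlinarith
    _ ≤ _ := by gcongr
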